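/- Let $(V,d)$ be a metric space (the set of sites), and for each $x\in V$ let $n_x\ge 1$ be the dimension of the spin space at $x$. For finite $X\subset V$ let $\mathcal A_X=\bigotimes_{x\in X}M_{n_x}(\mathbb C)$ with the operator norm, and for $X\subset\Lambda$ identify $A\in\mathcal A_X$ with $A\otimes 1\in\mathcal A_\Lambda$. Let $F:[0,\infty)\to(0,\infty)$ be non-increasing with $$\|F\|=\sup_{x}\sum_{y}F(d(x,y))<\infty,\qquad C=\sup_{x,y}\sum_{z}\frac{F(d(x,z))F(d(z,y))}{F(d(x,y))}<\infty .$$ For $a\ge 0$ put $F_a(r)=e^{-ar}F(r)$, and let $\|F_a\|$ and $C_a$ be the same quantities for $F_a$. Let $\Phi$ be an interaction, i.e. $\Phi(Z)=\Phi(Z)^*\in\mathcal A_Z$ for every finite $Z\subset V$. Fix $a>0$ and assume $$\|\Phi\|_a=\sup_{x,y}\sum_{Z\ni x,y}\frac{\|\Phi(Z)\|}{F_a(d(x,y))}<\infty .$$ For finite $\Lambda\subset V$ let $H_\Lambda=\sum_{Z\subset\Lambda}\Phi(Z)$ and $\tau_t^\Lambda(A)=e^{itH_\Lambda}Ae^{-itH_\Lambda}$.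 For finite $X\subset V$ let $\partial_\Phi X$ be the set of those $x\in X$ for which there is a finite $Z\subset V$ with $x\in Z$, $Z\cap X\ne\emptyset$, $Z\cap(V\setminus X)\neq\emptyset$ and $\Phi(Z)\ne0$. For $Y\subset\Lambda$ and $A\in\mathcal A_\Lambda$ let $$\langle A\rangle_{Y}=\int_{\mathcal U(Y)}U^*AU\,\mu(dU),$$ where $\mathcal U(Y)$ is the group of unitaries of $\mathcal A_Y$ and $\mu$ its normalized Haar measure. Let $X\subset V$ be finite, $A\in\mathcal A_X$, $\epsilon>0$ and $t\in\mathbb R$. Then for every finite $\Lambda\subset V$ with $X\subset\Lambda$, setting $$B=B_t(\epsilon,A)=\Big\{x\in\Lambda:\ d(x,X)\le\frac{2\|\Phi\|_aC_a}{a}|t|+\epsilon\Big\},\qquad B^c=\Lambda\setminus B,$$ the observable $\langle\tau_t^\Lambda(A)\rangle_{B^c}$ belongs to $\mathcal A_{B}$, and $$\big\|\tau_t^\Lambda(A)-\langle\tau_t^\Lambda(A)\rangle_{B^c}\big\|\le\int_{\mathcal U(B^c)}\big\|[\tau_t^\Lambda(A),U]\big\|\,\mu(dU)\le\frac{2\|A\|\,|\partial_\Phi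 X|}{C_a}\,\|F_0\|\,e^{-a\epsilon}.$$ The right-hand side does not depend on $\Lambda$ or $t$: time-evolved local observables are approximately supported in balls whose radius grows linearly in time. -/

import Mathlib

open scoped Matrix.Norms.L2Operator ENNReal

namespace QuantumSpin

noncomputable section

/-! ### Observables

The site `x` carries the Hilbert space `ℂ ^ n x`. The Hilbert space of a finite set `Λ` is the tensor
product of these spaces; its standard product basis is indexed by the configurations of `Λ`. The
algebra `⨂ x ∈ Λ, M_{n x}` is the algebra of matrices indexed by configurations, with the operator
norm (`Matrix.Norms.L2Operator`). -/

/-- Configurations of `Λ`: the labels of the product basis of `⨂ x ∈ Λ, ℂ ^ n x`. -/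
abbrev Config {V : Type*} (n : V → ℕ) (Λ : Finset V) : Type _ :=
  (x : Λ) → Fin (n x)

/-- The algebra of observables of the finite set `Λ`. -/
abbrev Obs {V : Type*} (n : V → ℕ) (Λ : Finset V) : Type _ :=
  Matrix (Config n Λ) (Config n Λ) ℂ

/-- The identification of `A` with `A ⊗ 1`, from the observables of `X` to those of `Λ ⊇ X`: the
matrix element between `σ` and `τ` is that of `A` between the restrictions of `σ` and `τ` to `X`,
times that of the identity between their restrictions to `Λ \ X`. -/
def embed {V : Type*} [DecidableEq V] {n : V → ℕ} {X Λ : Finset V} (h : X ⊆ Λ) (A : Obs n X) :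
    Obs n Λ :=
  Matrix.of fun σ τ =>
    A (Finset.restrict₂ (π := fun x => Fin (n x)) h σ)
        (Finset.restrict₂ (π := fun x => Fin (n x)) h τ) *
      (1 : Obs n (Λ \ X))
        (Finset.restrict₂ (π := fun x => Fin (n x)) Finset.sdiff_subset σ)
        (Finset.restrict₂ (π := fun x => Fin (n x)) Finset.sdiff_subset τ)

/-- The subset `𝒜_X` of the observables of `Λ ⊇ X`. -/
def localObs {V : Type*} [DecidableEq V] (n : V → ℕ) {X Λ : Finset V} (h : X ⊆ Λ) :
    Set (Obs n Λ) :=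
  Set.range (embed h)

/-! ### Interactions and dynamics -/

/-- An interaction: a self-adjoint observable `Φ Z` of `Z` for every finite set `Z` of sites. -/
structure Interaction {V : Type*} (n : V → ℕ) where
  toFun : (Z : Finset V) → Obs n Z
  isHermitian : ∀ Z, (toFun Z).IsHermitian

instance {V : Type*} (n : V → ℕ) : CoeFun (Interaction n) fun _ => (Z : Finset V) → Obs n Z :=
  ⟨Interaction.toFun⟩

/-- The local Hamiltonian `H_Λ = ∑_{Z ⊆ Λ} Φ(Z)`. -/
def hamiltonian {V : Type*} [DecidableEq V] {n : V → ℕ} (Φ : Interaction n) (Λ : Finset V) :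
    Obs n Λ :=
  ∑ Z ∈ Λ.powerset.attach, embed (Finset.mem_powerset.1 Z.2) (Φ Z.1)

/-- The time evolution `τ_t^Λ(A) = exp(i t H_Λ) A exp(-i t H_Λ)`. -/
def evolve {V : Type*} [DecidableEq V] {n : V → ℕ} (Φ : Interaction n) (Λ : Finset V) (t : ℝ)
    (A : Obs n Λ) : Obs n Λ :=
  NormedSpace.exp ((Complex.I * (t : ℂ)) • hamiltonian Φ Λ) * A *
    NormedSpace.exp (-(Complex.I * (t : ℂ)) • hamiltonian Φ Λ)

/-! ### Decay functions and norms of interactions -/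

/-- `F_a(r) = exp(-a r) F(r)`. -/
def weighted (F : ℝ → ℝ) (a : ℝ) : ℝ → ℝ := fun r => Real.exp (-(a * r)) * F r

/-- `‖F‖ = sup_x ∑_y F(d(x,y))`. -/
def decayNorm (V : Type*) [MetricSpace V] (F : ℝ → ℝ) : ℝ≥0∞ :=
  ⨆ x : V, ∑' y : V, ENNReal.ofReal (F (dist x y))

/-- `C = sup_{x,y} ∑_z F(d(x,z)) F(d(z,y)) / F(d(x,y))`. -/
def convConst (V : Type*) [MetricSpace V] (F : ℝ → ℝ) : ℝ≥0∞ :=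
  ⨆ (x : V) (y : V), ∑' z : V, ENNReal.ofReal (F (dist x z) * F (dist z y) / F (dist x y))

/-- A non-increasing function `F : [0, ∞) → (0, ∞)`, given by its values on `[0, ∞)`, which is
uniformly integrable over `V` and has a finite convolution constant. -/
structure IsDecayFunction (V : Type*) [MetricSpace V] (F : ℝ → ℝ) : Prop where
  pos : ∀ r, 0 ≤ r → 0 < F r
  antitoneOn : AntitoneOn F (Set.Ici 0)
  decayNorm_lt_top : decayNorm V F < ⊤
  convConst_lt_top : convConst V F < ⊤

/-- `‖Φ‖_a = sup_{x,y} ∑_{Z ∋ x,y} ‖Φ(Z)‖ / F_a(d(x,y))`, the sum over finite sets `Z` of sites. -/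
def Interaction.norm {V : Type*} [MetricSpace V] [DecidableEq V] {n : V → ℕ} (Φ : Interaction n)
    (F : ℝ → ℝ) (a : ℝ) : ℝ≥0∞ :=
  ⨆ (x : V) (y : V), ∑' Z : {Z : Finset V // x ∈ Z ∧ y ∈ Z},
    ENNReal.ofReal (‖Φ Z.1‖ / weighted F a (dist x y))

open Classical in
/-- The `Φ`-boundary of `X`: the sites of `X` which lie in a finite set `Z` that meets both `X` and
its complement in `V` and for which `Φ(Z) ≠ 0`. -/
def Interaction.boundary {V : Type*} {n : V → ℕ} (Φ : Interaction n) (X : Finset V) : Finset V :=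
  X.filter fun x => ∃ Z : Finset V,
    (∃ y ∈ Z, y ∈ X) ∧ (∃ y ∈ Z, y ∉ X) ∧ x ∈ Z ∧ Φ Z ≠ 0

open Classical in
/-- `{x ∈ Λ : d(x, X) ≤ r}`. -/
def ball {V : Type*} [MetricSpace V] (Λ X : Finset V) (r : ℝ) : Finset V :=
  Λ.filter fun x => Metric.infEDist x (X : Set V) ≤ ENNReal.ofReal r

theorem ball_subset {V : Type*} [MetricSpace V] (Λ X : Finset V) (r : ℝ) : ball Λ X r ⊆ Λ :=
  Finset.filter_subset _ _

/-! ### Haar average over unitaries -/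

/-- The Borel sigma-algebra of the unitary group. -/
instance unitaryMeasurableSpace (m : Type*) [Fintype m] [DecidableEq m] :
    MeasurableSpace (Matrix.unitaryGroup m ℂ) := borel _

instance unitaryBorelSpace (m : Type*) [Fintype m] [DecidableEq m] :
    BorelSpace (Matrix.unitaryGroup m ℂ) := ⟨rfl⟩

instance unitaryCompactSpace (m : Type*) [Fintype m] [DecidableEq m] :
    CompactSpace (Matrix.unitaryGroup m ℂ) := by
  have : ProperSpace (Matrix m m ℂ) := FiniteDimensional.proper ℂ _
  refine isCompact_iff_compactSpace.1 (Metric.isCompact_of_isClosed_isBounded ?_ ?_)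
  · have : (Matrix.unitaryGroup m ℂ : Set (Matrix m m ℂ)) =
        {U | star U * U = 1} ∩ {U | U * star U = 1} := by
      ext U; exact Unitary.mem_iff
    rw [this]
    exact (isClosed_eq (by fun_prop) (by fun_prop)).inter
      (isClosed_eq (by fun_prop) (by fun_prop))
  · refine (Metric.isBounded_closedBall (x := (0 : Matrix m m ℂ)) (r := 1)).subset fun U hU => ?_
    rw [mem_closedBall_zero_iff]
    rcases subsingleton_or_nontrivial (Matrix m m ℂ) with h | h
    · rw [Subsingleton.elim U 0, norm_zero]
      exact zero_le_one
    · exact (CStarRing.norm_of_mem_unitary hU).le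

/-- The normalized Haar measure of the unitary group. -/
def unitaryHaar (m : Type*) [Fintype m] [DecidableEq m] :
    MeasureTheory.Measure (Matrix.unitaryGroup m ℂ) :=
  MeasureTheory.Measure.haarMeasure ⊤

instance unitaryHaar_isProbabilityMeasure (m : Type*) [Fintype m] [DecidableEq m] :
    MeasureTheory.IsProbabilityMeasure (unitaryHaar m) :=
  ⟨MeasureTheory.Measure.haarMeasure_self⟩

instance unitaryHaar_isHaarMeasure (m : Type*) [Fintype m] [DecidableEq m] :
    (unitaryHaar m).IsHaarMeasure :=
  MeasureTheory.Measure.isHaarMeasure_haarMeasure ⊤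

/-- `⟨A⟩_Y = ∫ U* A U dμ(U)`, over the unitary group of the Hilbert space of `Y ⊆ Λ`. -/
def haarAverage {V : Type*} [DecidableEq V] {n : V → ℕ} {Y Λ : Finset V} (h : Y ⊆ Λ)
    (A : Obs n Λ) : Obs n Λ :=
  ∫ U : Matrix.unitaryGroup (Config n Y) ℂ,
    star (embed h (U : Obs n Y)) * A * embed h (U : Obs n Y) ∂unitaryHaar (Config n Y)

end

end QuantumSpin

/-! The core is a Lieb-Robinson bound: for disjoint `X` and `Y`, `[τ_t(A), B]` is at most
`2‖A‖‖B‖/C_a · (e^{2‖Φ‖_a C_a |t|} - 1)` times the sum of `F_a(d(x,y))` over `x ∈ ∂_Φ X`, `y ∈ Y`.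
To see only the boundary of the support `Z` of `A`, split off from `H` the terms crossing that
boundary. The remaining dynamics keeps `A` local in `Z` and preserves its norm, so in the
interaction picture the commutator grows at rate at most `2‖A‖ ∑ ‖[τ_s(Φ(W)), B]‖` over crossing
`W`. This is a closed system of integral inequalities indexed by finite sets. Instead of summing its
iterates, it is compared with an explicit supersolution
(`norm_commutator_heisenberg_le_of_supersolution`), built in `lieb_robinson` from the convolution
property of `F_a`. Outside `B`, sites lie at distance at least the chosen radius from `X`, and the
factor `e^{-a·radius}` absorbs the exponential growth in time and leaves `e^{-aε}`. The Haar average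
commutes with every unitary of `B^c`, hence with the whole algebra they span, so it has the form `N
⊗ 1`. It differs from `τ_t(A)` by an average of terms of norm `‖[τ_t(A), U]‖`. -/

namespace QuantumSpin

/-! ### Heisenberg dynamics in a C*-algebra -/

section Dynamics

variable {𝔄 : Type*} [CStarAlgebra 𝔄]

/-- The one-parameter group `exp(i t H)`. -/
noncomputable def propagator (H : 𝔄) (t : ℝ) : 𝔄 := NormedSpace.exp (t • (Complex.I • H))

theorem propagator_zero (H : 𝔄) : propagator H 0 = 1 := by
  simp [propagator]

theorem propagator_mul_neg (H : 𝔄) (t : ℝ) : propagator H t * propagator H (-t) = 1 := by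
  unfold propagator
  let _ : NormedAlgebra ℚ 𝔄 := .restrictScalars ℚ ℂ 𝔄
  rw [← NormedSpace.exp_add_of_commute]
  · simp
  · rw [neg_smul]; exact (Commute.refl _).neg_right

theorem propagator_neg_mul (H : 𝔄) (t : ℝ) : propagator H (-t) * propagator H t = 1 := by
  simpa using propagator_mul_neg H (-t)

theorem star_propagator {H : 𝔄} (hH : IsSelfAdjoint H) (t : ℝ) :
    star (propagator H t) = propagator H (-t) := by
  unfold propagator
  rw [NormedSpace.star_exp]
  congr 1
  simp [hH.star_eq, star_smul]

theorem propagator_mem_unitary {H : 𝔄} (hH : IsSelfAdjoint H) (t : ℝ) :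
    propagator H t ∈ unitary 𝔄 := by
  rw [Unitary.mem_iff, star_propagator hH]
  exact ⟨propagator_neg_mul H t, propagator_mul_neg H t⟩

theorem propagator_add {H K : 𝔄} (h : Commute H K) (t : ℝ) :
    propagator (H + K) t = propagator H t * propagator K t := by
  unfold propagator
  let _ : NormedAlgebra ℚ 𝔄 := .restrictScalars ℚ ℂ 𝔄
  rw [← NormedSpace.exp_add_of_commute]
  · simp
  · exact ((h.smul_left _).smul_right _).smul_left _ |>.smul_right _

theorem commute_propagator {H b : 𝔄} (h : Commute H b) (t : ℝ) : Commute (propagator H t) b :=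
  Commute.exp_left ((h.smul_left _).smul_left _)

theorem hasDerivAt_propagator (H : 𝔄) (t : ℝ) :
    HasDerivAt (propagator H) (propagator H t * (Complex.I • H)) t :=
  hasDerivAt_exp_smul_const (Complex.I • H) t

theorem hasDerivAt_propagator' (H : 𝔄) (t : ℝ) :
    HasDerivAt (propagator H) ((Complex.I • H) * propagator H t) t :=
  hasDerivAt_exp_smul_const' (Complex.I • H) t

theorem hasDerivAt_propagator_neg' (H : 𝔄) (t : ℝ) :
    HasDerivAt (fun s => propagator H (-s)) (-((Complex.I • H) * propagator H (-t))) t := by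
  simpa [Function.comp_def] using (hasDerivAt_propagator' H (-t)).scomp t (hasDerivAt_neg t)

/-- The Heisenberg evolution generated by `H`. -/
noncomputable def heisenberg (H : 𝔄) (t : ℝ) (A : 𝔄) : 𝔄 :=
  propagator H t * A * propagator H (-t)

theorem norm_conj_unitary_le {U V : 𝔄} (hU : U ∈ unitary 𝔄) (hV : V ∈ unitary 𝔄) (A : 𝔄) :
    ‖U * A * V‖ = ‖A‖ := by
  rw [CStarRing.norm_mul_mem_unitary _ hV, CStarRing.norm_mem_unitary_mul _ hU]

theorem norm_heisenberg {H : 𝔄} (hH : IsSelfAdjoint H) (t : ℝ) (A : 𝔄) :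
    ‖heisenberg H t A‖ = ‖A‖ :=
  norm_conj_unitary_le (propagator_mem_unitary hH _) (propagator_mem_unitary hH _) A

theorem heisenberg_sum {ι : Type*} (H : 𝔄) (t : ℝ) (s : Finset ι) (f : ι → 𝔄) :
    heisenberg H t (∑ i ∈ s, f i) = ∑ i ∈ s, heisenberg H t (f i) := by
  simp [heisenberg, Finset.mul_sum, Finset.sum_mul]

theorem heisenberg_neg_heisenberg (H : 𝔄) (t : ℝ) (A : 𝔄) :
    heisenberg H (-t) (heisenberg H t A) = A := by
  unfold heisenberg
  rw [neg_neg]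
  calc _ = (propagator H (-t) * propagator H t) * A * (propagator H (-t) * propagator H t) := by
        noncomm_ring
    _ = A := by rw [propagator_neg_mul]; simp

theorem norm_commutator_le (A B : 𝔄) : ‖A * B - B * A‖ ≤ 2 * ‖A‖ * ‖B‖ := by
  calc _ ≤ ‖A * B‖ + ‖B * A‖ := norm_sub_le _ _
    _ ≤ ‖A‖ * ‖B‖ + ‖B‖ * ‖A‖ := add_le_add (norm_mul_le _ _) (norm_mul_le _ _)
    _ = _ := by ring

/-- The two generators cancel except for `H - H₀`. Moving the evolution from `B` to `H - H₀` exposes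
a commutator with the fixed `B`, the kind of quantity being estimated, inside norm-preserving
conjugations when `H` and `H₀` are self-adjoint. -/
theorem hasDerivAt_interaction_picture (H H₀ B : 𝔄) (t : ℝ) :
    HasDerivAt (fun s => heisenberg H₀ s (heisenberg H (-s) B))
      (-(Complex.I • heisenberg H₀ t (heisenberg H (-t)
        (heisenberg H t (H - H₀) * B - B * heisenberg H t (H - H₀))))) t := by
  have h1 := (hasDerivAt_propagator H₀ t).mul
    ((((hasDerivAt_propagator_neg' H t).mul_const B).mul (hasDerivAt_propagator H t)))
  have h2 := h1.mul (hasDerivAt_propagator_neg' H₀ t)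
  unfold heisenberg
  simp only [neg_neg]
  refine h2.congr_deriv ?_
  have e := propagator_neg_mul H t
  set W := propagator H₀ t
  set W' := propagator H₀ (-t)
  set U := propagator H t
  set U' := propagator H (-t)
  have e1 : U' * ((U * (H - H₀) * U') * B - B * (U * (H - H₀) * U')) * U =
      (H - H₀) * (U' * B * U) - (U' * B * U) * (H - H₀) := by
    calc _ = (U' * U) * (H - H₀) * (U' * B * U) - (U' * B * U) * (H - H₀) * (U' * U) := by
          noncomm_ring
      _ = _ := by rw [e]; simp
  rw [e1]
  simp only [Pi.mul_apply, smul_mul_assoc, mul_smul_comm, mul_sub, sub_mul, mul_add, add_mul,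
    smul_sub, neg_sub, mul_neg, neg_mul, mul_assoc]
  abel

/-- Conjugating by unitaries turns the commutator into that of the fixed `A` with the
interaction-picture evolution of `B`. The norm of its derivative is at most the quantity in `hb`, so
`β` bounds it by the mean value inequality. -/
theorem norm_commutator_heisenberg_le {H H₀ A B : 𝔄} (hH : IsSelfAdjoint H)
    (hH₀ : IsSelfAdjoint H₀) {t : ℝ} (ht : 0 ≤ t) {β β' : ℝ → ℝ}
    (hβ : ∀ s, HasDerivAt β (β' s) s) (h0 : ‖A * B - B * A‖ ≤ β 0)
    (hb : ∀ s, 0 ≤ s → 2 * ‖A‖ *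
      ‖heisenberg H s (H - H₀) * B - B * heisenberg H s (H - H₀)‖ ≤ β' s) :
    ‖heisenberg H t (heisenberg H₀ (-t) A) * B - B * heisenberg H t (heisenberg H₀ (-t) A)‖
      ≤ β t := by
  have hd : ∀ s, HasDerivAt (fun s => A * heisenberg H₀ s (heisenberg H (-s) B) -
      heisenberg H₀ s (heisenberg H (-s) B) * A) _ s := fun s =>
    ((hasDerivAt_interaction_picture H H₀ B s).const_mul A).sub
      ((hasDerivAt_interaction_picture H H₀ B s).mul_const A)
  have key := image_norm_le_of_norm_deriv_right_le_deriv_boundary (a := 0) (b := t)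
    (fun s _ => (hd s).continuousAt.continuousWithinAt)
    (fun s _ => (hd s).hasDerivWithinAt) (B := β) (B' := β') ?_ hβ ?_ (Set.right_mem_Icc.2 ht)
  · refine le_of_eq_of_le ?_ key
    have e (x : 𝔄) : propagator H t * (propagator H (-t) * x) = x := by
      rw [← mul_assoc, propagator_mul_neg, one_mul]
    have f (x : 𝔄) : propagator H₀ (-t) * (propagator H₀ t * x) = x := by
      rw [← mul_assoc, propagator_neg_mul, one_mul]
    have key' : heisenberg H t (heisenberg H₀ (-t) A) * B -
        B * heisenberg H t (heisenberg H₀ (-t) A) =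
        propagator H t * (propagator H₀ (-t) * (A * heisenberg H₀ t (heisenberg H (-t) B) -
          heisenberg H₀ t (heisenberg H (-t) B) * A) * propagator H₀ t) * propagator H (-t) := by
      simp only [heisenberg, neg_neg, mul_sub, sub_mul, mul_assoc, e, f, propagator_mul_neg,
        mul_one]
    rw [key', norm_conj_unitary_le (propagator_mem_unitary hH t) (propagator_mem_unitary hH (-t)),
      norm_conj_unitary_le (propagator_mem_unitary hH₀ (-t)) (propagator_mem_unitary hH₀ t)]
  · simpa [heisenberg, propagator_zero] using h0
  · intro s hs
    refine le_trans ?_ (hb s hs.1)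
    refine (norm_commutator_le _ _).trans_eq ?_
    rw [norm_neg, norm_smul, norm_heisenberg hH₀, norm_heisenberg hH]
    simp

/-! ### Comparison with a supersolution -/

/-- `W` meets both `Z` and its complement. -/
def Crosses {V : Type*} (W Z : Finset V) : Prop := ¬ W ⊆ Z ∧ ¬ Disjoint W Z

theorem hasDerivAt_pow_div_factorial (K s : ℝ) (N : ℕ) :
    HasDerivAt (fun r => (K * r) ^ (N + 1) / (N + 1).factorial)
      (K * ((K * s) ^ N / N.factorial)) s := by
  have h := ((((hasDerivAt_id s).const_mul K).pow (N + 1)).div_const ((N + 1).factorial : ℝ))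
  refine h.congr_deriv ?_
  have : (N.factorial : ℝ) ≠ 0 := by positivity
  rw [Nat.factorial_succ]
  push_cast
  have : (N : ℝ) + 1 ≠ 0 := by positivity
  simp only [id]
  field_simp

-- A function dominating the initial commutators and satisfying the differential inequality of the
-- hierarchy bounds the commutators at all later times. Locality of `A` in `Z` is expressed as
-- commutation with everything supported off `Z`, which is all the argument needs and is easily seen
-- to survive the evolution.
open Classical in
theorem norm_commutator_heisenberg_le_of_supersolution {V : Type*}
    (P : Finset (Finset V)) (φ : Finset V → 𝔄) (hφ : ∀ W, IsSelfAdjoint (φ W))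
    (M : Finset V → Set 𝔄)
    (hM : ∀ W₁ W₂, Disjoint W₁ W₂ → ∀ a ∈ M W₁, ∀ b ∈ M W₂, Commute a b)
    (hφM : ∀ W ∈ P, φ W ∈ M W) {Y : Finset V} {B : 𝔄} (hB : B ∈ M Y)
    (u u' : Finset V → ℝ → ℝ) (hu : ∀ Z s, HasDerivAt (u Z) (u' Z s) s)
    (hu0 : ∀ Z s, 0 ≤ s → 0 ≤ u Z s) (huY : ∀ Z, ¬ Disjoint Z Y → 2 * ‖B‖ ≤ u Z 0)
    (hu' : ∀ Z s, 0 ≤ s → 2 * ∑ W ∈ P with Crosses W Z, ‖φ W‖ * u W s ≤ u' Z s)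
    {Z : Finset V} {A : 𝔄} (hA : ∀ W, Disjoint Z W → ∀ b ∈ M W, Commute A b)
    {t : ℝ} (ht : 0 ≤ t) :
    ‖heisenberg (∑ W ∈ P, φ W) t A * B - B * heisenberg (∑ W ∈ P, φ W) t A‖ ≤ ‖A‖ * u Z t := by
  set H := ∑ W ∈ P, φ W with hHdef
  have hH : IsSelfAdjoint H := isSelfAdjoint_sum _ fun W _ => hφ W
  set K : ℝ := 2 * ∑ W ∈ P, ‖φ W‖ with hK
  -- Picard iteration: the trivial bound gives the case `N = 0`, and each use of the hierarchy turns
  -- the error `(Kt)^N/N!` into the next one. The crude constant `K` disappears as `N → ∞`.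
  have main : ∀ N : ℕ, ∀ Z : Finset V, ∀ A : 𝔄, (∀ W, Disjoint Z W → ∀ b ∈ M W, Commute A b) →
      ∀ t : ℝ, 0 ≤ t → ‖heisenberg H t A * B - B * heisenberg H t A‖ ≤
        ‖A‖ * (u Z t + 2 * ‖B‖ * ((K * t) ^ N / N.factorial)) := by
    intro N
    induction N with
    | zero =>
      intro Z A _ t ht
      refine (norm_commutator_le _ _).trans ?_
      rw [norm_heisenberg hH]
      have := mul_nonneg (norm_nonneg A) (hu0 Z t ht)
      simp only [pow_zero, Nat.factorial_zero, Nat.cast_one, div_one, mul_one]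
      linarith
    | succ N ih =>
      intro Z A hA t ht
      set H₁ := ∑ W ∈ P with W ⊆ Z, φ W with hH₁
      set H₂ := ∑ W ∈ P with ¬ W ⊆ Z ∧ Disjoint W Z, φ W with hH₂
      set S := ∑ W ∈ P with Crosses W Z, φ W with hS
      have hsum : H = H₁ + H₂ + S := by
        simp only [hHdef, hH₁, hH₂, hS, Finset.sum_filter, ← Finset.sum_add_distrib]
        refine Finset.sum_congr rfl fun W _ => ?_
        by_cases h1 : W ⊆ Z <;> by_cases h2 : Disjoint W Z <;> simp [Crosses, h1, h2]
      have hS' : H - (H₁ + H₂) = S := by rw [hsum]; abel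
      have hH12 : IsSelfAdjoint (H₁ + H₂) :=
        (isSelfAdjoint_sum _ fun W _ => hφ W).add (isSelfAdjoint_sum _ fun W _ => hφ W)
      have hcomm : Commute H₁ H₂ := by
        refine Commute.sum_left _ _ _ fun W₁ h₁ => Commute.sum_right _ _ _ fun W₂ h₂ => ?_
        rw [Finset.mem_filter] at h₁ h₂
        exact hM W₁ W₂ (Disjoint.mono_left h₁.2 h₂.2.2.symm) _ (hφM _ h₁.1) _ (hφM _ h₂.1)
      have hAH₂ : Commute A H₂ := by
        refine Commute.sum_right _ _ _ fun W h => ?_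
        rw [Finset.mem_filter] at h
        exact hA W h.2.2.symm _ (hφM _ h.1)
      -- The terms off `Z` commute with `H₁` and `A`, so only the terms inside `Z` move `A`.
      have hA₀ : heisenberg (H₁ + H₂) t A = heisenberg H₁ t A := by
        unfold heisenberg
        rw [propagator_add hcomm, add_comm H₁ H₂, propagator_add hcomm.symm,
          mul_assoc (propagator H₁ t), (commute_propagator hAH₂.symm t).eq]
        calc _ = propagator H₁ t * A * (propagator H₂ t * propagator H₂ (-t)) *
              propagator H₁ (-t) := by noncomm_ring
          _ = _ := by rw [propagator_mul_neg, mul_one]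
      have hloc : ∀ W, Disjoint Z W → ∀ b ∈ M W, Commute (heisenberg H₁ t A) b := by
        intro W hW b hb
        have hb₁ : Commute H₁ b := by
          refine Commute.sum_left _ _ _ fun W₁ h₁ => ?_
          rw [Finset.mem_filter] at h₁
          exact hM W₁ W (Disjoint.mono_left h₁.2 hW) _ (hφM _ h₁.1) _ hb
        exact ((commute_propagator hb₁ t).mul_left (hA W hW b hb)).mul_left
          (commute_propagator hb₁ (-t))
      have hnorm : ‖heisenberg (H₁ + H₂) t A‖ = ‖A‖ := norm_heisenberg hH12 t A
      -- Starting from `A` already evolved by the uncoupled dynamics, for the final time `t`, makes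
      -- the backward evolution in the conclusion return exactly `A`.
      have key := norm_commutator_heisenberg_le (A := heisenberg (H₁ + H₂) t A) (B := B) hH hH12 ht
        (β := fun s => ‖A‖ * (u Z s + 2 * ‖B‖ * ((K * s) ^ (N + 1) / (N + 1).factorial)))
        (fun s => ((hu Z s).add
          ((hasDerivAt_pow_div_factorial K s N).const_mul (2 * ‖B‖))).const_mul ‖A‖) ?_ ?_
      · rwa [heisenberg_neg_heisenberg] at key
      · have hpow : (K * 0) ^ (N + 1) / ((N + 1).factorial : ℝ) = 0 := by simp
        show _ ≤ ‖A‖ * (u Z 0 + 2 * ‖B‖ * ((K * 0) ^ (N + 1) / ((N + 1).factorial : ℝ)))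
        rw [hpow, mul_zero, add_zero]
        by_cases hd : Disjoint Z Y
        · rw [hA₀, (hloc Y hd B hB).eq, sub_self, norm_zero]
          exact mul_nonneg (norm_nonneg A) (hu0 Z 0 le_rfl)
        · refine (norm_commutator_le _ _).trans ?_
          rw [hnorm]
          have := mul_le_mul_of_nonneg_left (huY Z hd) (norm_nonneg A)
          linarith
      · intro s hs
        rw [hnorm, hS']
        set D : ℝ := 2 * ‖B‖ * ((K * s) ^ N / N.factorial) with hD
        have hK0 : 0 ≤ K := mul_nonneg two_pos.le (Finset.sum_nonneg fun W _ => norm_nonneg _)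
        have hD0 : 0 ≤ D := by positivity
        have h1 : ‖heisenberg H s S * B - B * heisenberg H s S‖ ≤
            ∑ W ∈ P with Crosses W Z, ‖φ W‖ * (u W s + D) := by
          rw [hS, heisenberg_sum, Finset.sum_mul, Finset.mul_sum, ← Finset.sum_sub_distrib]
          refine norm_sum_le_of_le _ fun W hW => ih W (φ W) (fun W' hW' b hb => ?_) s hs
          exact hM W W' hW' _ (hφM W (Finset.mem_filter.1 hW).1) b hb
        have h2 : ∑ W ∈ P with Crosses W Z, ‖φ W‖ * D ≤ ∑ W ∈ P, ‖φ W‖ * D :=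
          Finset.sum_le_sum_of_subset_of_nonneg (Finset.filter_subset _ _) fun W _ _ => by positivity
        have h3 : 2 * ∑ W ∈ P, ‖φ W‖ * D = K * D := by rw [← Finset.sum_mul, hK]; ring
        simp only [mul_add, Finset.sum_add_distrib] at h1
        have h4 := hu' Z s hs
        calc _ = ‖A‖ * (2 * ‖heisenberg H s S * B - B * heisenberg H s S‖) := by ring
          _ ≤ ‖A‖ * (u' Z s + 2 * ‖B‖ * (K * ((K * s) ^ N / N.factorial))) := by
            refine mul_le_mul_of_nonneg_left ?_ (norm_nonneg A)
            have : 2 * ‖B‖ * (K * ((K * s) ^ N / N.factorial)) = K * D := by rw [hD]; ring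
            linarith
  have hlim : Filter.Tendsto (fun N : ℕ => ‖A‖ * (u Z t + 2 * ‖B‖ * ((K * t) ^ N / N.factorial)))
      Filter.atTop (nhds (‖A‖ * (u Z t + 2 * ‖B‖ * 0))) :=
    (((FloorSemiring.tendsto_pow_div_factorial_atTop (K * t)).const_mul _).const_add _).const_mul _
  have := ge_of_tendsto' hlim fun N => main N Z A hA t ht
  simpa using this

end Dynamics

/-! ### Tensor factors and commutants -/

section Embedding

open Kronecker

variable {V : Type*} [DecidableEq V] {n : V → ℕ}

/-- A configuration of `Λ` is a configuration of `X ⊆ Λ` and one of `Λ \ X`. -/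
noncomputable def splitConfig (n : V → ℕ) {X Λ : Finset V} (h : X ⊆ Λ) :
    Config n Λ ≃ Config n X × Config n (Λ \ X) :=
  Equiv.ofBijective
    (fun σ => (Finset.restrict₂ (π := fun x => Fin (n x)) h σ,
      Finset.restrict₂ (π := fun x => Fin (n x)) Finset.sdiff_subset σ)) <| by
    constructor
    · intro σ τ hστ
      rw [Prod.ext_iff] at hστ
      ext ⟨x, hx⟩
      by_cases hxX : x ∈ X
      · exact congrArg Fin.val (congrFun hστ.1 ⟨x, hxX⟩)
      · exact congrArg Fin.val (congrFun hστ.2 ⟨x, Finset.mem_sdiff.2 ⟨hx, hxX⟩⟩)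
    · rintro ⟨α, β⟩
      refine ⟨fun x => if hxX : x.1 ∈ X then α ⟨x, hxX⟩ else
        β ⟨x, Finset.mem_sdiff.2 ⟨x.2, hxX⟩⟩, Prod.ext ?_ ?_⟩
      · ext x
        simp [Finset.restrict₂]
      · ext x
        simp [Finset.restrict₂, (Finset.mem_sdiff.1 x.2).2]

theorem embed_eq_submatrix {X Λ : Finset V} (h : X ⊆ Λ) (A : Obs n X) :
    embed h A = (A ⊗ₖ (1 : Obs n (Λ \ X))).submatrix (splitConfig n h) (splitConfig n h) := rfl

theorem embed_one {X Λ : Finset V} (h : X ⊆ Λ) : embed h (1 : Obs n X) = 1 := by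
  rw [embed_eq_submatrix, Matrix.one_kronecker_one, Matrix.submatrix_one_equiv]

theorem embed_mul {X Λ : Finset V} (h : X ⊆ Λ) (A B : Obs n X) :
    embed h (A * B) = embed h A * embed h B := by
  rw [embed_eq_submatrix, embed_eq_submatrix, embed_eq_submatrix, Matrix.submatrix_mul_equiv,
    ← Matrix.mul_kronecker_mul, one_mul]

theorem embed_add {X Λ : Finset V} (h : X ⊆ Λ) (A B : Obs n X) :
    embed h (A + B) = embed h A + embed h B := by
  rw [embed_eq_submatrix, embed_eq_submatrix, embed_eq_submatrix, Matrix.add_kronecker]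
  rfl

theorem embed_smul {X Λ : Finset V} (h : X ⊆ Λ) (c : ℂ) (A : Obs n X) :
    embed h (c • A) = c • embed h A := by
  rw [embed_eq_submatrix, embed_eq_submatrix, Matrix.smul_kronecker]
  rfl

theorem embed_star {X Λ : Finset V} (h : X ⊆ Λ) (A : Obs n X) :
    embed h (star A) = star (embed h A) := by
  rw [embed_eq_submatrix, embed_eq_submatrix, Matrix.star_eq_conjTranspose,
    Matrix.star_eq_conjTranspose, Matrix.conjTranspose_submatrix, Matrix.conjTranspose_kronecker,
    Matrix.conjTranspose_one]

/-- The identification `A ↦ A ⊗ 1` as a star algebra homomorphism. -/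
noncomputable def embedHom {X Λ : Finset V} (h : X ⊆ Λ) : Obs n X →⋆ₐ[ℂ] Obs n Λ where
  toFun := embed h
  map_one' := embed_one h
  map_mul' := embed_mul h
  map_zero' := by simpa using embed_smul h 0 (0 : Obs n X)
  map_add' := embed_add h
  commutes' c := by
    rw [Algebra.algebraMap_eq_smul_one, embed_smul, embed_one, Algebra.algebraMap_eq_smul_one]
  map_star' := embed_star h

theorem norm_embed_le {X Λ : Finset V} (h : X ⊆ Λ) (A : Obs n X) : ‖embed h A‖ ≤ ‖A‖ :=
  NonUnitalStarAlgHom.norm_apply_le (embedHom h) A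

theorem continuous_embed {X Λ : Finset V} (h : X ⊆ Λ) :
    Continuous (embed h : Obs n X → Obs n Λ) :=
  (embedHom h).toAlgHom.toLinearMap.continuous_of_finiteDimensional

theorem embed_mem_unitary {X Λ : Finset V} (h : X ⊆ Λ) {U : Obs n X}
    (hU : U ∈ unitary (Obs n X)) : embed h U ∈ unitary (Obs n Λ) :=
  Unitary.map_mem (embedHom h) hU

theorem embed_eq_one_kronecker {X W Λ : Finset V} (hX : X ⊆ Λ) (hW : W ⊆ Λ \ X) (C : Obs n W) :
    embed (hW.trans Finset.sdiff_subset) C =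
      ((1 : Obs n X) ⊗ₖ embed hW C).submatrix (splitConfig n hX) (splitConfig n hX) := by
  ext σ τ
  simp only [Matrix.submatrix_apply, Matrix.kroneckerMap_apply, embed, Matrix.of_apply]
  rw [mul_left_comm]
  congr 1
  simp only [Matrix.one_apply, mul_ite, mul_one, mul_zero, ← ite_and]
  -- Both identity factors test the same agreement, since `Λ \ W` is the disjoint union of `X` and
  -- `(Λ \ X) \ W`.
  refine if_congr ⟨fun h => ⟨?_, ?_⟩, fun h => ?_⟩ rfl rfl
  · ext x
    have hx := Finset.mem_sdiff.1 x.2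
    exact congrArg Fin.val (congrFun h ⟨x, Finset.mem_sdiff.2 ⟨(Finset.mem_sdiff.1 hx.1).1, hx.2⟩⟩)
  · ext x
    have hx : x.1 ∉ W := fun hx => (Finset.mem_sdiff.1 (hW hx)).2 x.2
    exact congrArg Fin.val (congrFun h ⟨x, Finset.mem_sdiff.2 ⟨hX x.2, hx⟩⟩)
  · ext x
    have hx := Finset.mem_sdiff.1 x.2
    by_cases hxX : x.1 ∈ X
    · have h' := congrFun h.2 ⟨x, hxX⟩
      exact congrArg Fin.val h'
    · have h' := congrFun h.1 ⟨x, Finset.mem_sdiff.2 ⟨Finset.mem_sdiff.2 ⟨hx.1, hxX⟩, hx.2⟩⟩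
      exact congrArg Fin.val h'

theorem commute_embed {X W Λ : Finset V} (hX : X ⊆ Λ) (hW : W ⊆ Λ) (hd : Disjoint X W)
    (A : Obs n X) (C : Obs n W) : Commute (embed hX A) (embed hW C) := by
  have hW' : W ⊆ Λ \ X := Finset.subset_sdiff.2 ⟨hW, hd.symm⟩
  rw [Commute, SemiconjBy, embed_eq_one_kronecker hX hW', embed_eq_submatrix,
    Matrix.submatrix_mul_equiv, Matrix.submatrix_mul_equiv, ← Matrix.mul_kronecker_mul,
    ← Matrix.mul_kronecker_mul]
  simp

theorem embed_refl {X : Finset V} (A : Obs n X) : embed (Finset.Subset.refl X) A = A := by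
  ext σ τ
  have : Subsingleton (Config n (X \ X)) := by
    rw [Finset.sdiff_self]; infer_instance
  simp only [embed, Matrix.of_apply]
  rw [Subsingleton.elim (Finset.restrict₂ (π := fun x => Fin (n x)) Finset.sdiff_subset σ)
    (Finset.restrict₂ (π := fun x => Fin (n x)) Finset.sdiff_subset τ), Matrix.one_apply_eq, mul_one]
  rfl

/-- A matrix on a product which commutes with `1 ⊗ C` for all `C` is of the form `N ⊗ 1`. -/
theorem eq_kronecker_one_of_commute {l m : Type*} [Fintype l] [DecidableEq l] [Fintype m]
    [DecidableEq m] [Nonempty m] {M : Matrix (l × m) (l × m) ℂ}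
    (hM : ∀ C : Matrix m m ℂ, Commute ((1 : Matrix l l ℂ) ⊗ₖ C) M) :
    ∃ N : Matrix l l ℂ, M = N ⊗ₖ (1 : Matrix m m ℂ) := by
  obtain ⟨k₀⟩ := ‹Nonempty m›
  refine ⟨Matrix.of fun i j => M (i, k₀) (j, k₀), ?_⟩
  ext ⟨i, k⟩ ⟨j, k'⟩
  -- Each block of `M` commutes with all matrix units, hence is scalar; its value is read off at
  -- `k₀`.
  have hblock : (Matrix.of fun k k' => M (i, k) (j, k') : Matrix m m ℂ) ∈
      Set.range (Matrix.scalar m) := by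
    rw [Matrix.mem_range_scalar_iff_commute_single']
    intro p q
    ext k k'
    have := congrFun (congrFun (hM (Matrix.single p q 1)).eq (i, k)) (j, k')
    simpa [Matrix.mul_apply, Fintype.sum_prod_type, Matrix.one_apply] using this
  obtain ⟨r, hr⟩ := hblock
  have h1 := congrFun (congrFun hr k) k'
  have h2 := congrFun (congrFun hr k₀) k₀
  simp only [Matrix.of_apply, Matrix.scalar_apply, Matrix.diagonal_apply] at h1 h2
  simp only [Matrix.kroneckerMap_apply, Matrix.of_apply, ← h1, ← h2, Matrix.one_apply]
  simp

theorem mem_localObs_of_commute (hn : ∀ x, 0 < n x) {B Λ : Finset V} (hB : B ⊆ Λ) {M : Obs n Λ}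
    (hM : ∀ C : Obs n (Λ \ B), Commute (embed Finset.sdiff_subset C) M) : M ∈ localObs n hB := by
  have : Nonempty (Config n (Λ \ B)) := ⟨fun x => ⟨0, hn x⟩⟩
  obtain ⟨N, hN⟩ := eq_kronecker_one_of_commute
    (M := M.submatrix (splitConfig n hB).symm (splitConfig n hB).symm) fun C => by
      have h := (hM C).eq
      rw [embed_eq_one_kronecker hB (Finset.Subset.refl _), embed_refl] at h
      have h' := congrArg
        (fun T : Obs n Λ => T.submatrix (splitConfig n hB).symm (splitConfig n hB).symm) h
      simp only [← Matrix.submatrix_mul_equiv _ _ _ (splitConfig n hB).symm _] at h'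
      rw [commute_iff_eq]
      simpa [Matrix.submatrix_submatrix] using h'
  refine ⟨N, ?_⟩
  rw [embed_eq_submatrix, ← hN]
  simp [Matrix.submatrix_submatrix]

end Embedding

/-! ### Decay functions and sums over the interaction -/

section Decay

variable {V : Type*} [MetricSpace V] {F : ℝ → ℝ}

theorem weighted_zero (F : ℝ → ℝ) : weighted F 0 = F := by
  ext r; simp [weighted]

theorem IsDecayFunction.weighted_pos (hF : IsDecayFunction V F) (a : ℝ) (x y : V) :
    0 < weighted F a (dist x y) :=
  mul_pos (Real.exp_pos _) (hF.pos _ dist_nonneg)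

/-- By the triangle inequality the exponential weights contribute a factor at most `1`, so `C_a ≤
C`. -/
theorem IsDecayFunction.convConst_weighted_lt_top (hF : IsDecayFunction V F) {a : ℝ}
    (ha : 0 ≤ a) : convConst V (weighted F a) < ⊤ := by
  refine lt_of_le_of_lt ?_ hF.convConst_lt_top
  refine iSup₂_mono fun x y => ENNReal.tsum_le_tsum fun z => ENNReal.ofReal_le_ofReal ?_
  have h1 := hF.pos _ (dist_nonneg (x := x) (y := y))
  have h2 := hF.pos _ (dist_nonneg (x := x) (y := z))
  have h3 := hF.pos _ (dist_nonneg (x := z) (y := y))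
  have e : weighted F a (dist x z) * weighted F a (dist z y) / weighted F a (dist x y) =
      Real.exp (a * (dist x y - (dist x z + dist z y))) *
        (F (dist x z) * F (dist z y) / F (dist x y)) := by
    have : a * (dist x y - (dist x z + dist z y)) =
        -(a * dist x z) + -(a * dist z y) - -(a * dist x y) := by ring
    rw [this, Real.exp_sub, Real.exp_add]
    unfold weighted
    field_simp
  rw [e]
  refine mul_le_of_le_one_left (by positivity) (Real.exp_le_one_iff.2 ?_)
  exact mul_nonpos_of_nonneg_of_nonpos ha (by linarith [dist_triangle x z y])

theorem IsDecayFunction.convConst_weighted_pos (hF : IsDecayFunction V F) {a : ℝ}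
    (ha : 0 ≤ a) [Nonempty V] : 0 < (convConst V (weighted F a)).toReal := by
  obtain ⟨x⟩ := ‹Nonempty V›
  refine ENNReal.toReal_pos (ne_of_gt ?_) (hF.convConst_weighted_lt_top ha).ne
  have h := hF.weighted_pos a x x
  calc 0 < ENNReal.ofReal (weighted F a (dist x x) * weighted F a (dist x x) /
          weighted F a (dist x x)) := ENNReal.ofReal_pos.2 (by positivity)
    _ ≤ _ := (ENNReal.le_tsum x).trans (le_iSup₂ (f := fun x y : V => ∑' z : V, ENNReal.ofReal
      (weighted F a (dist x z) * weighted F a (dist z y) / weighted F a (dist x y))) x x)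

theorem IsDecayFunction.sum_conv_le (hF : IsDecayFunction V F) {a : ℝ} (ha : 0 ≤ a)
    (T : Finset V) (x y : V) :
    ∑ z ∈ T, weighted F a (dist x z) * weighted F a (dist z y) ≤
      (convConst V (weighted F a)).toReal * weighted F a (dist x y) := by
  have hpos := hF.weighted_pos a
  rw [← div_le_iff₀ (hpos x y), Finset.sum_div]
  rw [← ENNReal.ofReal_le_iff_le_toReal (hF.convConst_weighted_lt_top ha).ne,
    ENNReal.ofReal_sum_of_nonneg fun z _ =>
      (div_pos (mul_pos (hpos x z) (hpos z y)) (hpos x y)).le]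
  exact (ENNReal.sum_le_tsum T).trans (le_iSup₂ (f := fun x y : V => ∑' z : V, ENNReal.ofReal
      (weighted F a (dist x z) * weighted F a (dist z y) / weighted F a (dist x y))) x y)

theorem IsDecayFunction.sum_le_decayNorm (hF : IsDecayFunction V F) (T : Finset V) (x : V) :
    ∑ y ∈ T, F (dist x y) ≤ (decayNorm V F).toReal := by
  rw [← ENNReal.ofReal_le_iff_le_toReal hF.decayNorm_lt_top.ne,
    ENNReal.ofReal_sum_of_nonneg fun y _ => (hF.pos _ dist_nonneg).le]
  exact (ENNReal.sum_le_tsum T).trans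
    (le_iSup (f := fun x : V => ∑' y : V, ENNReal.ofReal (F (dist x y))) x)

variable {n : V → ℕ}

/-- The sum of `F_a(d(x,y))` over `x` in the boundary of `Z` and `y ∈ Y`. -/
noncomputable def Interaction.boundarySum (Φ : Interaction n) (F : ℝ → ℝ) (a : ℝ)
    (Z Y : Finset V) : ℝ :=
  ∑ x ∈ Φ.boundary Z, ∑ y ∈ Y, weighted F a (dist x y)

theorem Interaction.boundarySum_nonneg (Φ : Interaction n) (hF : IsDecayFunction V F) (a : ℝ)
    (Z Y : Finset V) : 0 ≤ Φ.boundarySum F a Z Y :=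
  Finset.sum_nonneg fun x _ => Finset.sum_nonneg fun y _ => (hF.weighted_pos a x y).le

variable [DecidableEq V]

theorem Interaction.sum_norm_le (Φ : Interaction n) (hF : IsDecayFunction V F) {a : ℝ}
    (hΦ : Φ.norm F a < ⊤) (P : Finset (Finset V)) (x y : V) :
    ∑ W ∈ P with x ∈ W ∧ y ∈ W, ‖Φ W‖ ≤ (Φ.norm F a).toReal * weighted F a (dist x y) := by
  have hpos := hF.weighted_pos a x y
  rw [← div_le_iff₀ hpos, Finset.sum_div, ← ENNReal.ofReal_le_iff_le_toReal hΦ.ne,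
    ENNReal.ofReal_sum_of_nonneg fun z _ => by positivity]
  refine le_trans ?_ (le_iSup₂ (f := fun x y : V => ∑' Z : {Z : Finset V // x ∈ Z ∧ y ∈ Z},
    ENNReal.ofReal (‖Φ Z.1‖ / weighted F a (dist x y))) x y)
  rw [show (∑' Z : {Z : Finset V // x ∈ Z ∧ y ∈ Z},
      ENNReal.ofReal (‖Φ Z.1‖ / weighted F a (dist x y))) = _ from
    tsum_subtype {Z : Finset V | x ∈ Z ∧ y ∈ Z}
      fun Z => ENNReal.ofReal (‖Φ Z‖ / weighted F a (dist x y))]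
  refine le_of_eq_of_le ?_ (ENNReal.sum_le_tsum P)
  rw [Finset.sum_filter]
  exact Finset.sum_congr rfl fun W _ => by simp [Set.indicator_apply]

-- A set `W` crossing `Z` with `Φ W ≠ 0` contains a point `x` of `∂_Φ Z`. Overcounting by all such
-- `x` leaves sums over `W` containing both `x` and `w`, which `‖Φ‖_a` controls.
open Classical in
theorem Interaction.sum_crosses_le (Φ : Interaction n) (hF : IsDecayFunction V F) {a : ℝ}
    (hΦ : Φ.norm F a < ⊤) (P : Finset (Finset V)) (Z T : Finset V) {g : V → ℝ}
    (hg : ∀ w, 0 ≤ g w) :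
    ∑ W ∈ P with Crosses W Z, ‖Φ W‖ * ∑ w ∈ T with w ∈ W, g w ≤
      (Φ.norm F a).toReal * ∑ x ∈ Φ.boundary Z, ∑ w ∈ T, weighted F a (dist x w) * g w := by
  calc _ ≤ ∑ W ∈ P with Crosses W Z, ∑ x ∈ Φ.boundary Z, ∑ w ∈ T,
        if x ∈ W ∧ w ∈ W then ‖Φ W‖ * g w else 0 := by
        refine Finset.sum_le_sum fun W hW => ?_
        obtain ⟨-, hW1, hW2⟩ := Finset.mem_filter.1 hW
        have hnn : ∀ x w, 0 ≤ if x ∈ W ∧ w ∈ W then ‖Φ W‖ * g w else 0 := fun x w => by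
          split_ifs
          · exact mul_nonneg (norm_nonneg _) (hg w)
          · exact le_rfl
        by_cases h0 : Φ W = 0
        · rw [h0, norm_zero, zero_mul]
          simp
        obtain ⟨y, hy, hyZ⟩ := Finset.not_subset.1 hW1
        obtain ⟨x, hx, hxZ⟩ := Finset.not_disjoint_iff.1 hW2
        have hxb : x ∈ Φ.boundary Z :=
          Finset.mem_filter.2 ⟨hxZ, W, ⟨x, hx, hxZ⟩, ⟨y, hy, hyZ⟩, hx, h0⟩
        refine le_of_eq_of_le ?_ (Finset.single_le_sum
          (fun x _ => Finset.sum_nonneg fun w _ => hnn x w) hxb)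
        rw [Finset.sum_filter, Finset.mul_sum]
        exact Finset.sum_congr rfl fun w _ => by simp [hx]
    _ ≤ ∑ W ∈ P, ∑ x ∈ Φ.boundary Z, ∑ w ∈ T,
        if x ∈ W ∧ w ∈ W then ‖Φ W‖ * g w else 0 := by
        refine Finset.sum_le_sum_of_subset_of_nonneg (Finset.filter_subset _ _) fun W _ _ =>
          Finset.sum_nonneg fun x _ => Finset.sum_nonneg fun w _ => ?_
        split_ifs
        · exact mul_nonneg (norm_nonneg _) (hg w)
        · exact le_rfl
    _ = ∑ x ∈ Φ.boundary Z, ∑ w ∈ T, (∑ W ∈ P with x ∈ W ∧ w ∈ W, ‖Φ W‖) * g w := by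
        rw [Finset.sum_comm]
        refine Finset.sum_congr rfl fun x _ => ?_
        rw [Finset.sum_comm]
        refine Finset.sum_congr rfl fun w _ => ?_
        rw [Finset.sum_mul, Finset.sum_filter]
    _ ≤ _ := by
        rw [Finset.mul_sum]
        refine Finset.sum_le_sum fun x _ => ?_
        rw [Finset.mul_sum]
        refine Finset.sum_le_sum fun w _ => ?_
        rw [← mul_assoc]
        refine mul_le_mul_of_nonneg_right ?_ (hg w)
        convert Φ.sum_norm_le hF hΦ P x w

open Classical in
theorem Interaction.sum_crosses_meets_le (Φ : Interaction n) (hF : IsDecayFunction V F) {a : ℝ}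
    (hΦ : Φ.norm F a < ⊤) (P : Finset (Finset V)) (Z Y : Finset V) :
    ∑ W ∈ P with Crosses W Z, ‖Φ W‖ * (if Disjoint W Y then 0 else 1) ≤
      (Φ.norm F a).toReal * Φ.boundarySum F a Z Y := by
  have h := Φ.sum_crosses_le hF hΦ P Z Y (g := fun _ => 1) fun _ => zero_le_one
  simp only [mul_one] at h
  refine le_trans (Finset.sum_le_sum fun W _ => ?_) h
  refine mul_le_mul_of_nonneg_left ?_ (norm_nonneg _)
  split_ifs with hd
  · exact Finset.sum_nonneg fun _ _ => zero_le_one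
  · obtain ⟨w, hw, hwY⟩ := Finset.not_disjoint_iff.1 hd
    exact Finset.single_le_sum (f := fun _ => (1 : ℝ)) (fun _ _ => zero_le_one)
      (Finset.mem_filter.2 ⟨hwY, hw⟩)

open Classical in
theorem Interaction.sum_crosses_boundarySum_le (Φ : Interaction n) (hF : IsDecayFunction V F)
    {a : ℝ} (ha : 0 ≤ a) (hΦ : Φ.norm F a < ⊤) {P : Finset (Finset V)} {Λ : Finset V}
    (hP : ∀ W ∈ P, W ⊆ Λ) (Z Y : Finset V) :
    ∑ W ∈ P with Crosses W Z, ‖Φ W‖ * Φ.boundarySum F a W Y ≤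
      (Φ.norm F a).toReal * ((convConst V (weighted F a)).toReal * Φ.boundarySum F a Z Y) := by
  have hg : ∀ w, 0 ≤ ∑ y ∈ Y, weighted F a (dist w y) := fun w =>
    Finset.sum_nonneg fun y _ => (hF.weighted_pos a w y).le
  refine le_trans (Finset.sum_le_sum fun W hW => ?_)
    ((Φ.sum_crosses_le hF hΦ P Z Λ hg).trans ?_)
  · refine mul_le_mul_of_nonneg_left ?_ (norm_nonneg _)
    -- The boundary of `W` is enlarged to all of `W`, after which the sum over intermediate sites is
    -- a convolution bounded by `C_a`.
    refine Finset.sum_le_sum_of_subset_of_nonneg (fun x hx => ?_) fun w _ _ => hg w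
    have hxW := (Finset.mem_filter.1 hx).1
    exact Finset.mem_filter.2 ⟨hP W (Finset.mem_filter.1 hW).1 hxW, hxW⟩
  · refine mul_le_mul_of_nonneg_left ?_ ENNReal.toReal_nonneg
    rw [boundarySum, Finset.mul_sum]
    refine Finset.sum_le_sum fun x _ => ?_
    simp only [Finset.mul_sum]
    rw [Finset.sum_comm]
    exact Finset.sum_le_sum fun y _ => hF.sum_conv_le ha Λ x y

end Decay

/-! ### The Hamiltonian as a sum of local terms -/

section LocalTerms

variable {V : Type*} [DecidableEq V] {n : V → ℕ}

/-- The observables of `W`, as observables of `Λ`, for `W ⊆ Λ`. -/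
def supported (n : V → ℕ) (Λ W : Finset V) : Set (Obs n Λ) :=
  {b | ∃ (h : W ⊆ Λ) (C : Obs n W), embed h C = b}

theorem commute_of_mem_supported {Λ W₁ W₂ : Finset V} (hd : Disjoint W₁ W₂) {a b : Obs n Λ}
    (ha : a ∈ supported n Λ W₁) (hb : b ∈ supported n Λ W₂) : Commute a b := by
  obtain ⟨h₁, A, rfl⟩ := ha
  obtain ⟨h₂, C, rfl⟩ := hb
  exact commute_embed h₁ h₂ hd A C

/-- The term of the Hamiltonian of `Λ` given by `W`. -/
noncomputable def localTerm (Φ : Interaction n) (Λ W : Finset V) : Obs n Λ :=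
  if h : W ⊆ Λ then embed h (Φ W) else 0

theorem hamiltonian_eq_sum (Φ : Interaction n) (Λ : Finset V) :
    hamiltonian Φ Λ = ∑ W ∈ Λ.powerset, localTerm Φ Λ W := by
  rw [hamiltonian, ← Finset.sum_attach Λ.powerset]
  exact Finset.sum_congr rfl fun W _ => by
    rw [localTerm, dif_pos (Finset.mem_powerset.1 W.2)]

theorem isSelfAdjoint_localTerm (Φ : Interaction n) (Λ W : Finset V) :
    IsSelfAdjoint (localTerm Φ Λ W) := by
  unfold localTerm
  split_ifs with h
  · rw [isSelfAdjoint_iff, ← embed_star]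
    exact congrArg _ (Φ.isHermitian W)
  · exact IsSelfAdjoint.zero _

theorem localTerm_mem_supported (Φ : Interaction n) {Λ W : Finset V} (hW : W ∈ Λ.powerset) :
    localTerm Φ Λ W ∈ supported n Λ W :=
  ⟨Finset.mem_powerset.1 hW, Φ W, by rw [localTerm, dif_pos (Finset.mem_powerset.1 hW)]⟩

theorem neg_localTerm_mem_supported (Φ : Interaction n) {Λ W : Finset V} (hW : W ∈ Λ.powerset) :
    -localTerm Φ Λ W ∈ supported n Λ W := by
  refine ⟨Finset.mem_powerset.1 hW, -Φ W, ?_⟩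
  rw [localTerm, dif_pos (Finset.mem_powerset.1 hW)]
  exact map_neg (embedHom (Finset.mem_powerset.1 hW)) (Φ W)

theorem norm_localTerm_le (Φ : Interaction n) (Λ W : Finset V) :
    ‖localTerm Φ Λ W‖ ≤ ‖Φ W‖ := by
  unfold localTerm
  split_ifs with h
  · exact norm_embed_le h _
  · simp

theorem evolve_eq_heisenberg (Φ : Interaction n) (Λ : Finset V) (t : ℝ) (A : Obs n Λ) :
    evolve Φ Λ t A = heisenberg (hamiltonian Φ Λ) t A := by
  have h : ∀ s : ℝ, (Complex.I * (s : ℂ)) • hamiltonian Φ Λ =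
      s • (Complex.I • hamiltonian Φ Λ) := fun s => by
    rw [mul_comm, mul_smul, Complex.coe_smul]
  rw [evolve, heisenberg, propagator, propagator, ← h, ← h]
  simp

theorem heisenberg_neg {𝔄 : Type*} [CStarAlgebra 𝔄] (H : 𝔄) (t : ℝ) (A : 𝔄) :
    heisenberg (-H) (-t) A = heisenberg H t A := by
  simp [heisenberg, propagator]

end LocalTerms

/-! ### The Lieb-Robinson bound -/

section LiebRobinson

variable {V : Type*} [MetricSpace V] {n : V → ℕ} {F : ℝ → ℝ}

theorem Interaction.boundarySum_le (Φ : Interaction n) (hF : IsDecayFunction V F) {a r : ℝ}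
    (ha : 0 ≤ a) {X Y : Finset V} (hr : ∀ x ∈ X, ∀ y ∈ Y, r ≤ dist x y) :
    Φ.boundarySum F a X Y ≤
      (Φ.boundary X).card * (Real.exp (-(a * r)) * (decayNorm V F).toReal) := by
  rw [← nsmul_eq_mul]
  refine Finset.sum_le_card_nsmul _ _ _ fun x hx => ?_
  have hxX : x ∈ X := (by classical exact Finset.mem_filter.1 hx : x ∈ X ∧ _).1
  calc _ ≤ ∑ y ∈ Y, Real.exp (-(a * r)) * F (dist x y) := by
        refine Finset.sum_le_sum fun y hy => ?_
        refine mul_le_mul_of_nonneg_right (Real.exp_le_exp.2 ?_) (hF.pos _ dist_nonneg).le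
        exact neg_le_neg (mul_le_mul_of_nonneg_left (hr x hxX y hy) ha)
    _ ≤ _ := by
        rw [← Finset.mul_sum]
        exact mul_le_mul_of_nonneg_left (hF.sum_le_decayNorm Y x) (Real.exp_pos _).le

variable [DecidableEq V]

/-- The local terms `φ` are only dominated in norm by `Φ`, so that both `Φ` and `-Φ` are covered;
the latter gives negative times. -/
theorem lieb_robinson (Φ : Interaction n) (hF : IsDecayFunction V F) {a : ℝ} (ha : 0 ≤ a)
    [Nonempty V] (hΦ : Φ.norm F a < ⊤) {Λ X Y : Finset V} (hX : X ⊆ Λ) (hY : Y ⊆ Λ)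
    (hd : Disjoint X Y) {φ : Finset V → Obs n Λ} (hφ : ∀ W, IsSelfAdjoint (φ W))
    (hφs : ∀ W ∈ Λ.powerset, φ W ∈ supported n Λ W) (hφn : ∀ W, ‖φ W‖ ≤ ‖Φ W‖)
    (A : Obs n X) (B : Obs n Y) {t : ℝ} (ht : 0 ≤ t) :
    ‖heisenberg (∑ W ∈ Λ.powerset, φ W) t (embed hX A) * embed hY B -
        embed hY B * heisenberg (∑ W ∈ Λ.powerset, φ W) t (embed hX A)‖ ≤
      2 * ‖A‖ * ‖B‖ / (convConst V (weighted F a)).toReal *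
        (Real.exp (2 * (Φ.norm F a).toReal * (convConst V (weighted F a)).toReal * t) - 1) *
        Φ.boundarySum F a X Y := by
  classical
  set C := (convConst V (weighted F a)).toReal with hC
  set N := (Φ.norm F a).toReal with hN
  have hC0 : 0 < C := hF.convConst_weighted_pos ha
  have hN0 : 0 ≤ N := ENNReal.toReal_nonneg
  have hG0 := fun Z => Φ.boundarySum_nonneg hF a Z Y
  set b := 2 * ‖embed hY B‖ with hb
  have hb0 : 0 ≤ b := by positivity
  have hexp : ∀ s, 0 ≤ s → 0 ≤ Real.exp (2 * N * C * s) - 1 := fun s hs =>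
    sub_nonneg.2 (Real.one_le_exp (by positivity))
  -- With `G(Z)` the boundary sum, crossing sums send the indicator of meeting `Y` to at most `N G`
  -- and `G` to at most `N C G`. The ansatz then closes: `2bN(G + (e^{2NCs} - 1)G)` is exactly `u'`.
  let u : Finset V → ℝ → ℝ := fun Z s =>
    b * ((if Disjoint Z Y then 0 else 1) +
      (Real.exp (2 * N * C * s) - 1) * (Φ.boundarySum F a Z Y / C))
  let u' : Finset V → ℝ → ℝ := fun Z s =>
    b * (2 * N * Φ.boundarySum F a Z Y * Real.exp (2 * N * C * s))
  have hu : ∀ Z s, HasDerivAt (u Z) (u' Z s) s := fun Z s => by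
    have h := ((((((hasDerivAt_id s).const_mul (2 * N * C)).exp).sub_const 1).mul_const
      (Φ.boundarySum F a Z Y / C)).const_add (if Disjoint Z Y then (0 : ℝ) else 1)).const_mul b
    refine h.congr_deriv ?_
    simp only [u', id]
    field_simp
  have hu0 : ∀ Z s, 0 ≤ s → 0 ≤ u Z s := fun Z s hs => by
    refine mul_nonneg hb0 (add_nonneg ?_ (mul_nonneg (hexp s hs) (div_nonneg (hG0 Z) hC0.le)))
    split_ifs <;> norm_num
  have huY : ∀ Z, ¬ Disjoint Z Y → b ≤ u Z 0 := fun Z hZ => by simp [u, hZ]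
  have hu' : ∀ Z s, 0 ≤ s →
      2 * ∑ W ∈ Λ.powerset with Crosses W Z, ‖φ W‖ * u W s ≤ u' Z s := fun Z s hs => by
    have h1 := Φ.sum_crosses_meets_le hF hΦ Λ.powerset Z Y
    have h2 := Φ.sum_crosses_boundarySum_le hF ha hΦ
      (fun W hW => Finset.mem_powerset.1 hW : ∀ W ∈ Λ.powerset, W ⊆ Λ) Z Y
    rw [← hN] at h1
    rw [← hN, ← hC] at h2
    have h3 : ∑ W ∈ Λ.powerset with Crosses W Z, ‖φ W‖ * u W s ≤
        ∑ W ∈ Λ.powerset with Crosses W Z, ‖Φ W‖ * u W s :=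
      Finset.sum_le_sum fun W _ => mul_le_mul_of_nonneg_right (hφn W) (hu0 W s hs)
    have h4 : ∑ W ∈ Λ.powerset with Crosses W Z, ‖Φ W‖ * u W s =
        b * (∑ W ∈ Λ.powerset with Crosses W Z, ‖Φ W‖ * (if Disjoint W Y then 0 else 1)) +
        b * ((Real.exp (2 * N * C * s) - 1) / C) *
          ∑ W ∈ Λ.powerset with Crosses W Z, ‖Φ W‖ * Φ.boundarySum F a W Y := by
      rw [Finset.mul_sum, Finset.mul_sum, ← Finset.sum_add_distrib]
      exact Finset.sum_congr rfl fun W _ => by simp only [u]; ring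
    have h5 := mul_le_mul_of_nonneg_left h1 hb0
    have h6 := mul_le_mul_of_nonneg_left h2
      (mul_nonneg hb0 (div_nonneg (hexp s hs) hC0.le))
    have h7 : b * ((Real.exp (2 * N * C * s) - 1) / C) * (N * (C * Φ.boundarySum F a Z Y)) =
        b * (Real.exp (2 * N * C * s) - 1) * (N * Φ.boundarySum F a Z Y) := by
      field_simp
    rw [h7] at h6
    simp only [u']
    linarith
  have hA : ∀ W, Disjoint X W → ∀ b ∈ supported n Λ W, Commute (embed hX A) b :=
    fun W hW b hb => commute_of_mem_supported hW ⟨hX, A, rfl⟩ hb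
  have key := norm_commutator_heisenberg_le_of_supersolution Λ.powerset φ hφ (supported n Λ)
    (fun W₁ W₂ h a ha b hb => commute_of_mem_supported h ha hb) hφs
    (⟨hY, B, rfl⟩ : embed hY B ∈ supported n Λ Y) u u' hu hu0 huY
    (fun Z s hs => by convert hu' Z s hs) hA ht
  refine key.trans ?_
  have hGX : 0 ≤ (Real.exp (2 * N * C * t) - 1) * (Φ.boundarySum F a X Y / C) :=
    mul_nonneg (hexp t ht) (div_nonneg (hG0 X) hC0.le)
  have hu_eq : u X t = b * ((Real.exp (2 * N * C * t) - 1) * (Φ.boundarySum F a X Y / C)) := by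
    simp [u, hd]
  rw [hu_eq]
  calc _ ≤ ‖A‖ * ((2 * ‖B‖) * ((Real.exp (2 * N * C * t) - 1) * (Φ.boundarySum F a X Y / C))) := by
        refine mul_le_mul (norm_embed_le hX A) ?_ (mul_nonneg hb0 hGX) (norm_nonneg _)
        refine mul_le_mul_of_nonneg_right ?_ hGX
        exact mul_le_mul_of_nonneg_left (norm_embed_le hY B) two_pos.le
    _ = _ := by ring

theorem norm_commutator_evolve_le (Φ : Interaction n) (hF : IsDecayFunction V F) {a : ℝ}
    (ha : 0 ≤ a) [Nonempty V] (hΦ : Φ.norm F a < ⊤) {Λ X Y : Finset V} (hX : X ⊆ Λ) (hY : Y ⊆ Λ)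
    (hd : Disjoint X Y) (A : Obs n X) (B : Obs n Y) (t : ℝ) :
    ‖evolve Φ Λ t (embed hX A) * embed hY B - embed hY B * evolve Φ Λ t (embed hX A)‖ ≤
      2 * ‖A‖ * ‖B‖ / (convConst V (weighted F a)).toReal *
        (Real.exp (2 * (Φ.norm F a).toReal * (convConst V (weighted F a)).toReal * |t|) - 1) *
        Φ.boundarySum F a X Y := by
  rw [evolve_eq_heisenberg, hamiltonian_eq_sum]
  rcases le_total 0 t with ht | ht
  · rw [abs_of_nonneg ht]
    exact lieb_robinson Φ hF ha hΦ hX hY hd (isSelfAdjoint_localTerm Φ Λ)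
      (fun W hW => localTerm_mem_supported Φ hW) (norm_localTerm_le Φ Λ) A B ht
  · rw [abs_of_nonpos ht, ← heisenberg_neg, ← Finset.sum_neg_distrib]
    exact lieb_robinson Φ hF ha hΦ hX hY hd (fun W => (isSelfAdjoint_localTerm Φ Λ W).neg)
      (fun W hW => neg_localTerm_mem_supported Φ hW)
      (fun W => (norm_neg _).trans_le (norm_localTerm_le Φ Λ W)) A B (neg_nonneg.2 ht)

theorem le_dist_of_notMem_ball {Λ X : Finset V} {r : ℝ} {x y : V} (hx : x ∈ X)
    (hy : y ∈ Λ \ ball Λ X r) : r ≤ dist x y := by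
  obtain ⟨hyΛ, hyB⟩ := Finset.mem_sdiff.1 hy
  by_contra! h
  refine hyB (Finset.mem_filter.2 ⟨hyΛ, ?_⟩)
  refine (Metric.infEDist_le_edist_of_mem (Finset.mem_coe.2 hx)).trans ?_
  rw [edist_dist, dist_comm]
  exact ENNReal.ofReal_le_ofReal h.le

theorem disjoint_sdiff_ball {Λ X : Finset V} {r : ℝ} : Disjoint X (Λ \ ball Λ X r) := by
  rw [Finset.disjoint_left]
  intro x hx hxB
  obtain ⟨hxΛ, hxB⟩ := Finset.mem_sdiff.1 hxB
  refine hxB (Finset.mem_filter.2 ⟨hxΛ, ?_⟩)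
  rw [Metric.infEDist_zero_of_mem (Finset.mem_coe.2 hx)]
  exact zero_le

end LiebRobinson

/-! ### Haar averages and localization -/

section HaarAverage

variable {V : Type*} [DecidableEq V] {n : V → ℕ} {Y Λ : Finset V}

instance unitaryHaar_isMulRightInvariant (m : Type*) [Fintype m] [DecidableEq m] :
    (unitaryHaar m).IsMulRightInvariant where
  map_mul_right_eq_self g := by
    -- A right translate is again a Haar probability measure, and there is only one.
    have : MeasureTheory.IsProbabilityMeasure ((unitaryHaar m).map (· * g)) :=
      MeasureTheory.Measure.isProbabilityMeasure_map (continuous_mul_const g).aemeasurable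
    exact MeasureTheory.Measure.isHaarMeasure_eq_of_isProbabilityMeasure _ _

theorem integrable_of_continuous_unitary {m E : Type*} [Fintype m] [DecidableEq m]
    [NormedAddCommGroup E] {f : Matrix.unitaryGroup m ℂ → E} (hf : Continuous f) :
    MeasureTheory.Integrable f (unitaryHaar m) :=
  hf.integrable_of_hasCompactSupport (HasCompactSupport.of_compactSpace f)

theorem continuous_embed_unitary (h : Y ⊆ Λ) :
    Continuous fun U : Matrix.unitaryGroup (Config n Y) ℂ => embed h (U : Obs n Y) :=
  (continuous_embed h).comp continuous_subtype_val

theorem continuous_conj_unitary (h : Y ⊆ Λ) (A : Obs n Λ) :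
    Continuous fun U : Matrix.unitaryGroup (Config n Y) ℂ =>
      star (embed h (U : Obs n Y)) * A * embed h (U : Obs n Y) := by
  have := continuous_embed_unitary (n := n) h
  fun_prop

/-- Under the integral, `A - U*AU = -U*[A, U]`, and the unitary factor does not change the norm. -/
theorem norm_sub_haarAverage_le (h : Y ⊆ Λ) (A : Obs n Λ) :
    ‖A - haarAverage h A‖ ≤ ∫ U : Matrix.unitaryGroup (Config n Y) ℂ,
      ‖A * embed h (U : Obs n Y) - embed h (U : Obs n Y) * A‖ ∂unitaryHaar (Config n Y) := by
  have hA : ∫ _ : Matrix.unitaryGroup (Config n Y) ℂ, A ∂unitaryHaar (Config n Y) = A := by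
    simp
  rw [haarAverage]
  conv_lhs =>
    enter [1, 1]
    rw [← hA]
  rw [← MeasureTheory.integral_sub (MeasureTheory.integrable_const A)
    (integrable_of_continuous_unitary (continuous_conj_unitary h A))]
  refine (MeasureTheory.norm_integral_le_integral_norm _).trans_eq ?_
  refine MeasureTheory.integral_congr_ae (.of_forall fun U => ?_)
  beta_reduce
  have hU := embed_mem_unitary h U.2
  have e : A - star (embed h (U : Obs n Y)) * A * embed h (U : Obs n Y) =
      -(star (embed h (U : Obs n Y)) *
        (A * embed h (U : Obs n Y) - embed h (U : Obs n Y) * A)) := by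
    rw [mul_sub, ← mul_assoc, ← mul_assoc, (Unitary.mem_iff.1 hU).1, one_mul, neg_sub]
  rw [e, norm_neg, CStarRing.norm_mem_unitary_mul _ (Unitary.star_mem hU)]

theorem commute_haarAverage_unitary (h : Y ⊆ Λ) (A : Obs n Λ)
    (W : Matrix.unitaryGroup (Config n Y) ℂ) :
    Commute (embed h (W : Obs n Y)) (haarAverage h A) := by
  have hW := embed_mem_unitary h W.2
  have hconj : haarAverage h A =
      star (embed h (W : Obs n Y)) * haarAverage h A * embed h (W : Obs n Y) := by
    -- The substitution `U ↦ UW` shows that the average is invariant under conjugation by `W`.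
    conv_lhs => rw [haarAverage, ← MeasureTheory.integral_mul_right_eq_self _ W]
    have hint := integrable_of_continuous_unitary (continuous_conj_unitary h A)
    rw [haarAverage, ← integral_const_mul_of_integrable hint,
      ← integral_mul_const_of_integrable (hint.const_mul _)]
    refine MeasureTheory.integral_congr_ae (.of_forall fun U => ?_)
    beta_reduce
    rw [Submonoid.coe_mul, embed_mul, star_mul]
    noncomm_ring
  rw [commute_iff_eq]
  conv_lhs => rw [hconj]
  rw [← mul_assoc, ← mul_assoc, (Unitary.mem_iff.1 hW).2, one_mul]

theorem commute_haarAverage (h : Y ⊆ Λ) (A : Obs n Λ) (C : Obs n Y) :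
    Commute (embed h C) (haarAverage h A) := by
  have hC : C ∈ Submodule.span ℂ (unitary (Obs n Y) : Set (Obs n Y)) := by
    rw [CStarAlgebra.span_unitary]; trivial
  induction hC using Submodule.span_induction with
  | mem U hU => exact commute_haarAverage_unitary h A ⟨U, hU⟩
  | zero => rw [show embed h (0 : Obs n Y) = 0 from map_zero (embedHom h)]; exact Commute.zero_left _
  | add x y _ _ hx hy => rw [embed_add]; exact hx.add_left hy
  | smul c x _ hx => rw [embed_smul]; exact hx.smul_left c

theorem haarAverage_mem_localObs (hn : ∀ x, 0 < n x) {B : Finset V} (hB : B ⊆ Λ) (A : Obs n Λ) :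
    haarAverage (Finset.sdiff_subset : Λ \ B ⊆ Λ) A ∈ localObs n hB :=
  mem_localObs_of_commute hn hB fun C => commute_haarAverage _ A C

theorem commute_of_isEmpty [IsEmpty V] (A B : Obs n Λ) : Commute A B := by
  ext σ τ
  simp only [Matrix.mul_apply]
  refine Finset.sum_congr rfl fun ρ _ => ?_
  have : Subsingleton (Config n Λ) := ⟨fun f g => funext fun x => (IsEmpty.false x.1).elim⟩
  rw [Subsingleton.elim σ τ, Subsingleton.elim ρ τ, mul_comm]

end HaarAverage

end QuantumSpin

/-! ### The localization theorem -/

theorem mainTheorem3 {V : Type*} [MetricSpace V] [DecidableEq V]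
    (n : V → ℕ) (hn : ∀ x, 0 < n x)
    (F : ℝ → ℝ) (hF : QuantumSpin.IsDecayFunction V F)
    (a : ℝ) (ha : 0 < a)
    (Φ : QuantumSpin.Interaction n) (hΦ : Φ.norm F a < ⊤)
    (X : Finset V) (A : QuantumSpin.Obs n X) (ε : ℝ) (hε : 0 < ε) (t : ℝ)
    (Λ : Finset V) (hX : X ⊆ Λ) :
    let Fa : ℝ → ℝ := QuantumSpin.weighted F a
    let Ca : ℝ := (QuantumSpin.convConst V Fa).toReal
    let B : Finset V :=
      QuantumSpin.ball Λ X (2 * (Φ.norm F a).toReal * Ca / a * |t| + ε)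
    let hB : B ⊆ Λ := QuantumSpin.ball_subset Λ X _
    let hBc : Λ \ B ⊆ Λ := Finset.sdiff_subset
    let τA : QuantumSpin.Obs n Λ := QuantumSpin.evolve Φ Λ t (QuantumSpin.embed hX A)
    QuantumSpin.haarAverage hBc τA ∈ QuantumSpin.localObs n hB ∧
    ‖τA - QuantumSpin.haarAverage hBc τA‖ ≤
      ∫ U : Matrix.unitaryGroup (QuantumSpin.Config n (Λ \ B)) ℂ,
        ‖τA * QuantumSpin.embed hBc (U : QuantumSpin.Obs n (Λ \ B)) -
          QuantumSpin.embed hBc (U : QuantumSpin.Obs n (Λ \ B)) * τA‖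
        ∂QuantumSpin.unitaryHaar (QuantumSpin.Config n (Λ \ B)) ∧
    ∫ U : Matrix.unitaryGroup (QuantumSpin.Config n (Λ \ B)) ℂ,
        ‖τA * QuantumSpin.embed hBc (U : QuantumSpin.Obs n (Λ \ B)) -
          QuantumSpin.embed hBc (U : QuantumSpin.Obs n (Λ \ B)) * τA‖
        ∂QuantumSpin.unitaryHaar (QuantumSpin.Config n (Λ \ B)) ≤
      2 * ‖A‖ * ((Φ.boundary X).card : ℝ) / Ca *
        (QuantumSpin.decayNorm V (QuantumSpin.weighted F 0)).toReal * Real.exp (-(a * ε)) := by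
  intro Fa Ca B hB hBc τA
  refine ⟨QuantumSpin.haarAverage_mem_localObs hn hB τA,
    QuantumSpin.norm_sub_haarAverage_le hBc τA, ?_⟩
  set R := 2 * ‖A‖ * ((Φ.boundary X).card : ℝ) / Ca *
    (QuantumSpin.decayNorm V (QuantumSpin.weighted F 0)).toReal * Real.exp (-(a * ε)) with hR
  suffices h : ∀ U : Matrix.unitaryGroup (QuantumSpin.Config n (Λ \ B)) ℂ,
      ‖τA * QuantumSpin.embed hBc (U : QuantumSpin.Obs n (Λ \ B)) -
        QuantumSpin.embed hBc (U : QuantumSpin.Obs n (Λ \ B)) * τA‖ ≤ R by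
    have hcont := QuantumSpin.continuous_embed_unitary (n := n) hBc
    refine (MeasureTheory.integral_mono
      (QuantumSpin.integrable_of_continuous_unitary (by fun_prop))
      (MeasureTheory.integrable_const R) h).trans_eq ?_
    simp
  intro U
  -- Without sites `C_a` is not positive, but the algebra is one-dimensional and the commutator
  -- vanishes.
  rcases isEmpty_or_nonempty V with hV | hV
  · rw [(QuantumSpin.commute_of_isEmpty τA _).eq, sub_self, norm_zero]
    positivity
  have hCa : 0 < Ca := hF.convConst_weighted_pos ha.le
  have hU : ‖(U : QuantumSpin.Obs n (Λ \ B))‖ = 1 := by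
    have : Nonempty (QuantumSpin.Config n (Λ \ B)) := ⟨fun x => ⟨0, hn x⟩⟩
    exact CStarRing.norm_of_mem_unitary U.2
  set N := (Φ.norm F a).toReal with hN
  set r := 2 * N * Ca / a * |t| + ε with hr
  have hLR := QuantumSpin.norm_commutator_evolve_le Φ hF ha.le hΦ hX hBc
    QuantumSpin.disjoint_sdiff_ball A (U : QuantumSpin.Obs n (Λ \ B)) t
  have hsum := Φ.boundarySum_le hF ha.le (r := r) (X := X) (Y := Λ \ B)
    fun x hx y hy => QuantumSpin.le_dist_of_notMem_ball hx hy
  have hG0 := Φ.boundarySum_nonneg hF a X (Λ \ B)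
  refine hLR.trans ?_
  rw [hU, mul_one, hR, QuantumSpin.weighted_zero]
  -- The velocity `2‖Φ‖_a C_a / a` in the radius is the one that cancels the growth in time; below,
  -- the `-1` is dropped.
  have hexp : Real.exp (2 * N * Ca * |t|) * Real.exp (-(a * r)) = Real.exp (-(a * ε)) := by
    rw [← Real.exp_add]
    congr 1
    rw [hr]
    field_simp
    ring
  calc 2 * ‖A‖ / Ca * (Real.exp (2 * N * Ca * |t|) - 1) * Φ.boundarySum F a X (Λ \ B)
      ≤ 2 * ‖A‖ / Ca * Real.exp (2 * N * Ca * |t|) *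
        ((Φ.boundary X).card * (Real.exp (-(a * r)) * (QuantumSpin.decayNorm V F).toReal)) := by
        refine mul_le_mul (mul_le_mul_of_nonneg_left (by linarith) (by positivity)) hsum hG0
          (by positivity)
    _ = _ := by rw [← hexp]; ring
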